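/- **Theorem (Hexagon Equation).** Let $\mathcal A$ be an arbitrary complex unital associative algebra, and let $\mathcal A[[\lambda]]$ be the algebra of formal power series in a formal parameter $\lambda$ with coefficients in $\mathcal A$. For $X,Y\in\mathcal A$ and $\delta,\epsilon\in\,]0,1/4]$ let $c_{\delta\epsilon}(s)=(1-s)\delta+s(1-\epsilon)$, $s\in[0,1]$, and let $W_{\delta\epsilon}(X,Y)=W(1)\in\mathcal A[[\lambda]]$ be the parallel transport along $c_{\delta\epsilon}$ of the connection $\left(\frac1x X+\frac1{x-1}Y\right)dx$, i.e. the value at $s=1$ of the unique solution $W$, with coefficients in $\mathcal C^\infty([0,1],\mathbb C)\otimes\mathcal A$ (algebraic tensor product), of $$\frac{dW}{ds}=\lambda\left(\frac{c_{\delta\epsilon}'(s)}{c_{\delta\epsilon}(s)}X+\frac{c_{\delta\epsilon}'(s)}{c_{\delta\epsilon}(s)-1}Y\right)W,\qquad W(0)=1 .$$ Define $\Phi_{\delta,\epsilon}(X,Y)$ by $W_{\delta\epsilon}(X,Y)=e^{\lambda\ln(\epsilon)Y}\,\Phi_{\delta,\epsilon}(X,Y)\,e^{-\lambda\ln(\delta)X}$.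 The Drinfel'd associator is $$\Phi(X,Y)=\lim_{(\delta,\epsilon)\to(0,0)}\Phi_{\delta,\epsilon}(X,Y)\in\mathcal A[[\lambda]],$$ the limit being taken for each coefficient of $\lambda^r$ separately, with respect to any norm on the complex vector space $\mathcal A$. Let $A,B,C\in\mathcal A$ be such that $\Lambda=A+B+C$ commutes with $A$, $B$ and $C$. Then the limits defining $\Phi(A,B)$, $\Phi(B,C)$ and $\Phi(C,A)$ exist (for every norm on $\mathcal A$, and independently of the norm), and in $\mathcal A[[\lambda]]$ $$e^{\lambda\pi\mathbf i\Lambda}=e^{\lambda\pi\mathbf iA}\,\Phi(C,A)\,e^{\lambda\pi\mathbf iC}\,\Phi(B,C)\,e^{\lambda\pi\mathbf iB}\,\Phi(A,B).$$ -/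

import Mathlib

open PowerSeries Filter Topology Set
open scoped Nat ContDiff

noncomputable section

namespace KZ

variable {𝒜 : Type*} [Ring 𝒜] [Algebra ℂ 𝒜]

/-- The formal exponential `e^{λx} = ∑ₙ λⁿ xⁿ / n!` in `𝒜⟦λ⟧` (the formal parameter `λ` is the
variable of the power series ring). -/
def formalExp (x : 𝒜) : PowerSeries 𝒜 :=
  PowerSeries.mk fun n => ((n ! : ℂ)⁻¹) • x ^ n

section FormalODE

variable {ι : Type*}

/-- `W : [0,1] → 𝒜⟦λ⟧` is the fundamental solution, normalized at `0`, of the formal linear ODE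
`dW/ds = λ Y W`, `W(0) = 1`, where `Y = ∑ᵢ fᵢ ⊗ aᵢ`. Every coefficient of `W` has to lie in the
algebraic tensor product `C^∞([0,1], ℂ) ⊗ 𝒜`, i.e. it is a finite sum `∑ₖ gₖ ⊗ bₖ` with `gₖ`
smooth on `[0,1]`, and its derivative is `∑ₖ gₖ' ⊗ bₖ`. -/
structure IsFundamentalSolution [Fintype ι] (f : ι → ℝ → ℂ) (a : ι → 𝒜) (W : ℝ → PowerSeries 𝒜) : Prop where
  init : W 0 = 1
  ode : ∀ r : ℕ, ∃ (n : ℕ) (g : Fin n → ℝ → ℂ) (b : Fin n → 𝒜),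
    (∀ k, ContDiffOn ℝ ∞ (g k) (Icc 0 1)) ∧
    (∀ s ∈ Icc (0 : ℝ) 1, coeff r (W s) = ∑ k, g k s • b k) ∧
    (∀ s ∈ Icc (0 : ℝ) 1, ∑ k, derivWithin (g k) (Icc 0 1) s • b k =
      coeff r (PowerSeries.X * (PowerSeries.C (∑ i, f i s • a i) * W s)))

/-- The iterated integral
`∫₀ˢ f_{w 0}(s₁) ∫₀^{s₁} f_{w 1}(s₂) ⋯ ∫₀^{s_{r-1}} f_{w (r-1)}(s_r) ds_r ⋯ ds₂ ds₁`. -/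
def iteratedIntegral (f : ι → ℝ → ℂ) : (r : ℕ) → (Fin r → ι) → ℝ → ℂ
  | 0, _, _ => 1
  | r + 1, w, s => ∫ t in (0 : ℝ)..s, f (w 0) t * iteratedIntegral f r (Fin.tail w) t

/-- The fundamental solution `s ↦ W_{s0}` of `dW/ds = λ Y W`, `W(0) = 1`, `Y = ∑ᵢ fᵢ ⊗ aᵢ`,
written out by iterated integrals. That this is the unique fundamental solution on `[0,1]`
is `isFundamentalSolution_fundamentalSolution` and `IsFundamentalSolution.unique` below. -/
def fundamentalSolution [Fintype ι] (f : ι → ℝ → ℂ) (a : ι → 𝒜) (s : ℝ) : PowerSeries 𝒜 :=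
  PowerSeries.mk fun r =>
    ∑ w : Fin r → ι, iteratedIntegral f r w s • (List.ofFn fun k => a (w k)).prod

theorem contDiffOn_integral {h : ℝ → ℂ} (hh : ContDiffOn ℝ ∞ h (Icc 0 1)) :
    (∀ s ∈ Icc (0 : ℝ) 1,
      HasDerivWithinAt (fun s => ∫ t in (0 : ℝ)..s, h t) (h s) (Icc 0 1) s) ∧
    ContDiffOn ℝ ∞ (fun s => ∫ t in (0 : ℝ)..s, h t) (Icc 0 1) := by
  have hu : UniqueDiffOn ℝ (Icc (0 : ℝ) 1) := uniqueDiffOn_Icc zero_lt_one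
  have key : ∀ s ∈ Icc (0 : ℝ) 1,
      HasDerivWithinAt (fun s => ∫ t in (0 : ℝ)..s, h t) (h s) (Icc 0 1) s := by
    intro s hs
    have hc := hh.continuousOn
    have : Fact (s ∈ Icc (0 : ℝ) 1) := ⟨hs⟩
    refine intervalIntegral.integral_hasDerivWithinAt_right ?_ ?_ (hc s hs)
    · refine (hc.mono ?_).intervalIntegrable
      rw [uIcc_of_le hs.1]
      exact Icc_subset_Icc_right hs.2
    · exact hc.stronglyMeasurableAtFilter_nhdsWithin measurableSet_Icc s
  refine ⟨key, ?_⟩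
  rw [contDiffOn_infty_iff_derivWithin hu]
  refine ⟨fun s hs => (key s hs).differentiableWithinAt, ?_⟩
  exact hh.congr fun s hs => (key s hs).derivWithin (hu s hs)

theorem contDiffOn_iteratedIntegral {f : ι → ℝ → ℂ}
    (hf : ∀ i, ContDiffOn ℝ ∞ (f i) (Icc 0 1)) :
    ∀ (r : ℕ) (w : Fin r → ι), ContDiffOn ℝ ∞ (iteratedIntegral f r w) (Icc 0 1)
  | 0, _ => contDiffOn_const
  | r + 1, w =>
    (contDiffOn_integral ((hf (w 0)).mul (contDiffOn_iteratedIntegral hf r (Fin.tail w)))).2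

theorem isFundamentalSolution_fundamentalSolution [Fintype ι] {f : ι → ℝ → ℂ}
    (hf : ∀ i, ContDiffOn ℝ ∞ (f i) (Icc 0 1)) (a : ι → 𝒜) :
    IsFundamentalSolution f a (fundamentalSolution f a) := by
  have hu : UniqueDiffOn ℝ (Icc (0 : ℝ) 1) := uniqueDiffOn_Icc zero_lt_one
  constructor
  · ext r
    cases r with
    | zero => simp [fundamentalSolution, iteratedIntegral]
    | succ r => simp [fundamentalSolution, iteratedIntegral, PowerSeries.coeff_one]
  · intro r
    classical
    let e := Fintype.equivFin (Fin r → ι)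
    refine ⟨Fintype.card (Fin r → ι), fun k => iteratedIntegral f r (e.symm k),
      fun k => (List.ofFn fun j => a (e.symm k j)).prod,
      fun k => contDiffOn_iteratedIntegral hf r _, fun s _ => ?_, fun s hs => ?_⟩
    · rw [fundamentalSolution, coeff_mk]
      exact (e.symm.sum_comp
        (fun w => iteratedIntegral f r w s • (List.ofFn fun j => a (w j)).prod)).symm
    · rw [e.symm.sum_comp (fun w => derivWithin (iteratedIntegral f r w) (Icc 0 1) s •
        (List.ofFn fun j => a (w j)).prod)]
      cases r with
      | zero =>
        have h1 : ∀ w : Fin 0 → ι, iteratedIntegral f 0 w = fun _ => 1 := fun w => rfl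
        simp [h1]
      | succ r =>
        rw [PowerSeries.coeff_succ_X_mul, PowerSeries.coeff_C_mul, fundamentalSolution, coeff_mk,
          Finset.sum_mul_sum, ← Finset.sum_product', Finset.univ_product_univ]
        refine (Fintype.sum_equiv (Fin.consEquiv fun _ => ι) _ _ ?_).symm
        rintro ⟨i, w⟩
        have hd : derivWithin (iteratedIntegral f (r + 1)
            ((Fin.consEquiv fun _ => ι) (i, w))) (Icc 0 1) s =
            f i s * iteratedIntegral f r w s :=
          ((contDiffOn_integral ((hf i).mul
            (contDiffOn_iteratedIntegral hf r w))).1 s hs).derivWithin (hu s hs)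
        rw [hd]
        simp only [Fin.consEquiv_apply, List.ofFn_succ, Fin.cons_zero, Fin.cons_succ,
          List.prod_cons, smul_mul_smul_comm]

theorem IsFundamentalSolution.unique [Fintype ι] {f : ι → ℝ → ℂ} {a : ι → 𝒜} {W W' : ℝ → PowerSeries 𝒜}
    (hW : IsFundamentalSolution f a W) (hW' : IsFundamentalSolution f a W')
    {s : ℝ} (hs : s ∈ Icc (0 : ℝ) 1) : W s = W' s := by
  have hu : UniqueDiffOn ℝ (Icc (0 : ℝ) 1) := uniqueDiffOn_Icc zero_lt_one
  have step : ∀ r : ℕ, (∀ s ∈ Icc (0 : ℝ) 1,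
      coeff r (PowerSeries.X * (PowerSeries.C (∑ i, f i s • a i) * W s)) =
        coeff r (PowerSeries.X * (PowerSeries.C (∑ i, f i s • a i) * W' s))) →
      ∀ s ∈ Icc (0 : ℝ) 1, coeff r (W s) = coeff r (W' s) := by
    intro r hr s hs
    obtain ⟨n, g, b, hg, hWr, hWd⟩ := hW.ode r
    obtain ⟨n', g', b', hg', hWr', hWd'⟩ := hW'.ode r
    refine sub_eq_zero.1 ((Module.forall_dual_apply_eq_zero_iff ℂ _).1 fun ℓ => ?_)
    have hℓ : ∀ t ∈ Icc (0 : ℝ) 1, ℓ (coeff r (W t) - coeff r (W' t)) =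
        ∑ k, g k t * ℓ (b k) - ∑ k, g' k t * ℓ (b' k) := by
      intro t ht
      simp [hWr t ht, hWr' t ht]
    have hd : ∀ t ∈ Icc (0 : ℝ) 1, HasDerivWithinAt
        (fun t => ∑ k, g k t * ℓ (b k) - ∑ k, g' k t * ℓ (b' k)) 0 (Icc 0 1) t := by
      intro t ht
      have e : (0 : ℂ) = ∑ k, derivWithin (g k) (Icc 0 1) t * ℓ (b k) -
          ∑ k, derivWithin (g' k) (Icc 0 1) t * ℓ (b' k) := by
        have := congrArg ℓ ((hWd t ht).trans ((hr t ht).trans (hWd' t ht).symm))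
        simp only [map_sum, map_smul, smul_eq_mul] at this
        rw [this, sub_self]
      rw [e]
      refine HasDerivWithinAt.sub (HasDerivWithinAt.fun_sum fun k _ => ?_)
        (HasDerivWithinAt.fun_sum fun k _ => ?_)
      · exact ((hg k).differentiableOn (by simp) t ht).hasDerivWithinAt.mul_const _
      · exact ((hg' k).differentiableOn (by simp) t ht).hasDerivWithinAt.mul_const _
    have hc := constant_of_derivWithin_zero (fun t ht => (hd t ht).differentiableWithinAt)
      (fun t ht => (hd t (Ico_subset_Icc_self ht)).derivWithin (hu t (Ico_subset_Icc_self ht)))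
      s hs
    simp only [← hℓ s hs, ← hℓ 0 ⟨le_rfl, zero_le_one⟩] at hc
    rw [hc, hW.init, hW'.init, sub_self, map_zero]
  have main : ∀ r : ℕ, ∀ s ∈ Icc (0 : ℝ) 1, coeff r (W s) = coeff r (W' s) := by
    intro r
    induction r with
    | zero => exact step 0 fun s _ => by simp
    | succ r ih =>
      refine step (r + 1) fun s hs => ?_
      rw [PowerSeries.coeff_succ_X_mul, PowerSeries.coeff_succ_X_mul, PowerSeries.coeff_C_mul,
        PowerSeries.coeff_C_mul, ih s hs]
  ext r
  exact main r s hs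

end FormalODE

/-- Coefficientwise limit in `𝒜⟦λ⟧` with respect to the norms on the complex vector space `𝒜`.
(For families whose coefficients stay in finite-dimensional subspaces all norms give the same
limits.) -/
def HasFormalLimit {T : Type*} (F : T → PowerSeries 𝒜) (l : Filter T) (ξ : PowerSeries 𝒜) : Prop :=
  ∀ p : Seminorm ℂ 𝒜, (∀ x, p x = 0 → x = 0) →
    ∀ r : ℕ, Tendsto (fun t => p (coeff r (F t) - coeff r ξ)) l (𝓝 0)

/-- Every complex vector space has a norm. -/
theorem exists_norm (E : Type*) [AddCommGroup E] [Module ℂ E] :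
    ∃ p : Seminorm ℂ E, ∀ x, p x = 0 → x = 0 := by
  let b := Module.Basis.ofVectorSpace ℂ E
  refine ⟨Seminorm.of (fun x => (b.repr x).sum fun _ z => ‖z‖) ?_ ?_, ?_⟩
  · intro x y
    classical
    simp only [map_add]
    have h1 : ∀ u : Module.Basis.ofVectorSpaceIndex ℂ E →₀ ℂ,
        u.support ⊆ (b.repr x).support ∪ (b.repr y).support →
        (u.sum fun _ z => ‖z‖) = ∑ i ∈ (b.repr x).support ∪ (b.repr y).support, ‖u i‖ :=
      fun u hu => Finsupp.sum_of_support_subset _ hu _ (by simp)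
    rw [h1 _ Finsupp.support_add, h1 _ Finset.subset_union_left, h1 _ Finset.subset_union_right,
      ← Finset.sum_add_distrib]
    exact Finset.sum_le_sum fun i _ => norm_add_le _ _
  · intro z x
    simp only [map_smul]
    rw [Finsupp.sum_smul_index' (by simp), Finsupp.sum, Finsupp.sum, Finset.mul_sum]
    simp
  · intro x hx
    have hx' : ∑ i ∈ (b.repr x).support, ‖b.repr x i‖ = 0 := hx
    rw [Finset.sum_eq_zero_iff_of_nonneg fun _ _ => norm_nonneg _] at hx'
    refine b.repr.map_eq_zero_iff.1 (Finsupp.ext fun i => ?_)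
    by_contra hi
    exact hi (norm_eq_zero.1 (hx' i (Finsupp.mem_support_iff.2 hi)))

theorem HasFormalLimit.unique {T : Type*} {F : T → PowerSeries 𝒜} {l : Filter T} [l.NeBot]
    {ξ ξ' : PowerSeries 𝒜} (h : HasFormalLimit F l ξ) (h' : HasFormalLimit F l ξ') : ξ = ξ' := by
  obtain ⟨p, hp⟩ := exists_norm 𝒜
  ext r
  refine sub_eq_zero.1 (hp _ (le_antisymm ?_ (apply_nonneg p _)))
  have h0 := (h p hp r).add (h' p hp r)
  rw [add_zero] at h0
  refine ge_of_tendsto' h0 fun t => ?_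
  have e : coeff r ξ - coeff r ξ' =
      (coeff r (F t) - coeff r ξ') - (coeff r (F t) - coeff r ξ) := by abel
  rw [e, add_comm]
  exact map_sub_le_add p _ _

/-- The two scalar components of the pull-back of the connection
`Γ(B,A) = (A / z + B / (z - 1)) dz` along a path `c`: one has
`Γ(B,A)^{(c)} = (c' / c) ⊗ A + (c' / (c - 1)) ⊗ B`. -/
def connectionCoeff (c : ℝ → ℂ) : Fin 2 → ℝ → ℂ :=
  ![fun s => deriv c s / c s, fun s => deriv c s / (c s - 1)]

/-- The parallel transport `W₁₀^{(c)}` of the connection `Γ(B,A) = (A / z + B / (z - 1)) dz`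
along the path `c`, from `c 0` to `c 1`. -/
def parallelTransport (A B : 𝒜) (c : ℝ → ℂ) : PowerSeries 𝒜 :=
  fundamentalSolution (connectionCoeff c) ![A, B] 1

/-- The affine path from `δ` to `1 - ε`. -/
def affinePath (δ ε : ℝ) (s : ℝ) : ℂ := (1 - s) * δ + s * (1 - ε)

theorem contDiffOn_connectionCoeff_affinePath {δ ε : ℝ} (hδ : δ ∈ Ioc (0 : ℝ) (1 / 4))
    (hε : ε ∈ Ioc (0 : ℝ) (1 / 4)) (i : Fin 2) :
    ContDiffOn ℝ ∞ (connectionCoeff (affinePath δ ε) i) (Icc 0 1) := by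
  have hc : ContDiff ℝ ∞ (affinePath δ ε) := by
    have : ContDiff ℝ ∞ (fun s : ℝ => (s : ℂ)) := Complex.ofRealCLM.contDiff
    unfold affinePath
    fun_prop
  have hc' : ContDiff ℝ ∞ (deriv (affinePath δ ε)) := (contDiff_infty_iff_deriv.1 hc).2
  have hre : ∀ s, affinePath δ ε s = (((1 - s) * δ + s * (1 - ε) : ℝ) : ℂ) := by
    intro s
    simp [affinePath]
  obtain ⟨hδ0, hδ1⟩ := hδ
  obtain ⟨hε0, hε1⟩ := hε
  fin_cases i
  · simp only [connectionCoeff, div_eq_mul_inv]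
    refine hc'.contDiffOn.mul (hc.contDiffOn.inv fun s hs => ?_)
    rw [hre, Complex.ofReal_ne_zero]
    have h0 := hs.1
    have h1 := hs.2
    nlinarith
  · simp only [connectionCoeff, div_eq_mul_inv]
    refine hc'.contDiffOn.mul ((hc.sub contDiff_const).contDiffOn.inv fun s hs => ?_)
    rw [hre, sub_ne_zero, ← Complex.ofReal_one, Complex.ofReal_inj.ne]
    have h0 := hs.1
    have h1 := hs.2
    nlinarith

/-- The non-singular part `Φ_{δ,ε}(A,B)` of the parallel transport from `δ` to `1 - ε`:
`W₁₀ = e^{λ ln(ε) B} Φ_{δ,ε}(A,B) e^{-λ ln(δ) A}`. -/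
def regularizedTransport (A B : 𝒜) (δ ε : ℝ) : PowerSeries 𝒜 :=
  formalExp (-(Real.log ε : ℂ) • B) * parallelTransport A B (affinePath δ ε) *
    formalExp ((Real.log δ : ℂ) • A)

/-- `Φ` is the limit of `Φ_{δ,ε}(A,B)` as `(δ,ε) → (0,0)` in `]0,1/4] × ]0,1/4]`. -/
def IsDrinfeldAssociator (A B : 𝒜) (Φ : PowerSeries 𝒜) : Prop :=
  HasFormalLimit (fun q : ℝ × ℝ => regularizedTransport A B q.1 q.2)
    (𝓝[Ioc (0 : ℝ) (1 / 4) ×ˢ Ioc (0 : ℝ) (1 / 4)] (0, 0)) Φ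

theorem IsDrinfeldAssociator.unique {A B : 𝒜} {Φ Φ' : PowerSeries 𝒜}
    (h : IsDrinfeldAssociator A B Φ) (h' : IsDrinfeldAssociator A B Φ') : Φ = Φ' := by
  have h1 : (𝓝[Ioc (0 : ℝ) (1 / 4)] 0).NeBot := by
    rw [nhdsWithin_Ioc_eq_nhdsGT (by norm_num)]
    infer_instance
  have : (𝓝[Ioc (0 : ℝ) (1 / 4) ×ˢ Ioc (0 : ℝ) (1 / 4)] ((0 : ℝ), (0 : ℝ))).NeBot := by
    rw [nhdsWithin_prod_eq]
    infer_instance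
  exact HasFormalLimit.unique h h'

open Classical in
/-- The Drinfel'd associator `Φ(A,B) = lim Φ_{δ,ε}(A,B)`. -/
def drinfeldAssociator (A B : 𝒜) : PowerSeries 𝒜 :=
  if h : ∃ Φ, IsDrinfeldAssociator A B Φ then h.choose else 0

end KZ

end

noncomputable section

namespace KZ

section Calculus

variable {T E : Type*} [AddCommGroup E] [Module ℂ E]

/-- `f` tends to `a` along `l` inside a finite-dimensional subspace: `f` is eventually a finite sum
`∑ₖ gₖ • bₖ` with convergent scalar coefficients. -/
def TendstoSum (f : T → E) (l : Filter T) (a : E) : Prop :=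
  ∃ (ι : Type) (_ : Fintype ι) (g : ι → T → ℂ) (c : ι → ℂ) (b : ι → E),
    (∀ k, Tendsto (g k) l (𝓝 (c k))) ∧ (∀ᶠ t in l, f t = ∑ k, g k t • b k) ∧
      a = ∑ k, c k • b k

theorem TendstoSum.const (l : Filter T) (a : E) : TendstoSum (fun _ => a) l a :=
  ⟨Unit, inferInstance, fun _ _ => 1, fun _ => 1, fun _ => a, fun _ => tendsto_const_nhds,
    by simp, by simp⟩

theorem TendstoSum.congr {f f' : T → E} {l : Filter T} {a : E} (h : TendstoSum f l a)
    (hf : ∀ᶠ t in l, f' t = f t) : TendstoSum f' l a := by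
  obtain ⟨ι, _, g, c, b, h1, h2, h3⟩ := h
  exact ⟨ι, _, g, c, b, h1, by filter_upwards [h2, hf] with t h h'; rw [h', h], h3⟩

theorem TendstoSum.comp {S : Type*} {f : T → E} {l : Filter T} {a : E} (h : TendstoSum f l a)
    {u : S → T} {m : Filter S} (hu : Tendsto u m l) : TendstoSum (fun s => f (u s)) m a := by
  obtain ⟨ι, _, g, c, b, h1, h2, h3⟩ := h
  exact ⟨ι, _, fun k s => g k (u s), c, b, fun k => (h1 k).comp hu, hu.eventually h2, h3⟩

theorem TendstoSum.add {f f' : T → E} {l : Filter T} {a a' : E} (h : TendstoSum f l a)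
    (h' : TendstoSum f' l a') : TendstoSum (fun t => f t + f' t) l (a + a') := by
  obtain ⟨ι, _, g, c, b, h1, h2, h3⟩ := h
  obtain ⟨ι', _, g', c', b', h1', h2', h3'⟩ := h'
  refine ⟨ι ⊕ ι', inferInstance, Sum.elim g g', Sum.elim c c', Sum.elim b b', ?_, ?_, ?_⟩
  · rintro (k | k)
    · exact h1 k
    · exact h1' k
  · filter_upwards [h2, h2'] with t e e'
    simp [e, e']
  · simp [h3, h3']

theorem TendstoSum.sum {κ : Type*} (s : Finset κ) {f : κ → T → E} {l : Filter T} {a : κ → E}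
    (h : ∀ i ∈ s, TendstoSum (f i) l (a i)) :
    TendstoSum (fun t => ∑ i ∈ s, f i t) l (∑ i ∈ s, a i) := by
  classical
  induction s using Finset.induction_on with
  | empty => simpa using TendstoSum.const l (0 : E)
  | insert i s hi ih =>
    simp only [Finset.sum_insert hi]
    exact (h i (Finset.mem_insert_self i s)).add
      (ih fun j hj => h j (Finset.mem_insert_of_mem hj))

theorem TendstoSum.smul {f : T → E} {l : Filter T} {a : E} (h : TendstoSum f l a)
    {u : T → ℂ} {x : ℂ} (hu : Tendsto u l (𝓝 x)) : TendstoSum (fun t => u t • f t) l (x • a) := by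
  obtain ⟨ι, _, g, c, b, h1, h2, h3⟩ := h
  refine ⟨ι, inferInstance, fun k t => u t * g k t, fun k => x * c k, b, fun k => hu.mul (h1 k), ?_, ?_⟩
  · filter_upwards [h2] with t e
    simp only [e, Finset.smul_sum, mul_smul]
  · simp only [h3, Finset.smul_sum, mul_smul]

theorem TendstoSum.tendsto_dual {f : T → E} {l : Filter T} {a : E} (h : TendstoSum f l a)
    (ℓ : Module.Dual ℂ E) : Tendsto (fun t => ℓ (f t)) l (𝓝 (ℓ a)) := by
  obtain ⟨ι, _, g, c, b, h1, h2, h3⟩ := h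
  have h4 : Tendsto (fun t => ∑ k, g k t * ℓ (b k)) l (𝓝 (∑ k, c k * ℓ (b k))) :=
    tendsto_finsetSum _ fun k _ => (h1 k).mul_const _
  have h5 : ℓ a = ∑ k, c k * ℓ (b k) := by simp [h3]
  rw [h5]
  refine h4.congr' ?_
  filter_upwards [h2] with t e
  simp [e]

theorem TendstoSum.unique {f : T → E} {l : Filter T} [l.NeBot] {a a' : E} (h : TendstoSum f l a)
    (h' : TendstoSum f l a') : a = a' := by
  refine sub_eq_zero.1 ((Module.forall_dual_apply_eq_zero_iff ℂ _).1 fun ℓ => ?_)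
  rw [map_sub, tendsto_nhds_unique (h.tendsto_dual ℓ) (h'.tendsto_dual ℓ), sub_self]

theorem TendstoSum.tendsto_seminorm {f : T → E} {l : Filter T} {a : E} (h : TendstoSum f l a)
    (p : Seminorm ℂ E) : Tendsto (fun t => p (f t - a)) l (𝓝 0) := by
  obtain ⟨ι, _, g, c, b, h1, h2, h3⟩ := h
  have h4 : Tendsto (fun t => ∑ k, ‖g k t - c k‖ * p (b k)) l (𝓝 (∑ k : ι, 0 * p (b k))) :=
    tendsto_finsetSum _ fun k _ =>
      (tendsto_iff_norm_sub_tendsto_zero.1 (h1 k)).mul_const _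
  simp only [zero_mul, Finset.sum_const_zero] at h4
  refine squeeze_zero' (Eventually.of_forall fun t => apply_nonneg p _) ?_ h4
  filter_upwards [h2] with t e
  rw [e, h3, ← Finset.sum_sub_distrib]
  refine (Finset.le_sum_of_subadditive p (map_zero p).le (map_add_le_add p) _ _).trans (Finset.sum_le_sum fun k _ => ?_)
  rw [← sub_smul, map_smul_eq_mul]

/-- On `U`, `f` is a finite sum `∑ₖ gₖ • bₖ` with holomorphic coefficients and `f'` is its
derivative. -/
def HolDeriv (U : Set ℂ) (f f' : ℂ → E) : Prop :=
  ∃ (ι : Type) (_ : Fintype ι) (g : ι → ℂ → ℂ) (b : ι → E),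
    (∀ k, DifferentiableOn ℂ (g k) U) ∧ (∀ z ∈ U, f z = ∑ k, g k z • b k) ∧
      ∀ z ∈ U, f' z = ∑ k, deriv (g k) z • b k

theorem HolDeriv.const (U : Set ℂ) (a : E) : HolDeriv U (fun _ => a) (fun _ => 0) :=
  ⟨Unit, inferInstance, fun _ _ => 1, fun _ => a, fun _ => differentiableOn_const _,
    by simp, by simp⟩

theorem HolDeriv.smul_const {U : Set ℂ} {g : ℂ → ℂ} (hg : DifferentiableOn ℂ g U) (b : E) :
    HolDeriv U (fun z => g z • b) (fun z => deriv g z • b) :=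
  ⟨Unit, inferInstance, fun _ => g, fun _ => b, fun _ => hg, by simp, by simp⟩

theorem HolDeriv.congr {U : Set ℂ} {f f' h h' : ℂ → E} (H : HolDeriv U f f')
    (e : ∀ z ∈ U, h z = f z) (e' : ∀ z ∈ U, h' z = f' z) : HolDeriv U h h' := by
  obtain ⟨ι, _, g, b, h1, h2, h3⟩ := H
  exact ⟨ι, _, g, b, h1, fun z hz => (e z hz).trans (h2 z hz),
    fun z hz => (e' z hz).trans (h3 z hz)⟩

theorem HolDeriv.mono {U V : Set ℂ} {f f' : ℂ → E} (H : HolDeriv U f f') (hV : V ⊆ U) :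
    HolDeriv V f f' := by
  obtain ⟨ι, _, g, b, h1, h2, h3⟩ := H
  exact ⟨ι, _, g, b, fun k => (h1 k).mono hV, fun z hz => h2 z (hV hz),
    fun z hz => h3 z (hV hz)⟩

theorem HolDeriv.add {U : Set ℂ} {f f' h h' : ℂ → E} (H : HolDeriv U f f')
    (H' : HolDeriv U h h') : HolDeriv U (fun z => f z + h z) (fun z => f' z + h' z) := by
  obtain ⟨ι, _, g, b, h1, h2, h3⟩ := H
  obtain ⟨ι', _, g', b', h1', h2', h3'⟩ := H'
  refine ⟨ι ⊕ ι', inferInstance, Sum.elim g g', Sum.elim b b', ?_, fun z hz => ?_,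
    fun z hz => ?_⟩
  · rintro (k | k)
    · exact h1 k
    · exact h1' k
  · simp [h2 z hz, h2' z hz]
  · simp [h3 z hz, h3' z hz]

theorem HolDeriv.sum {κ : Type*} (s : Finset κ) {U : Set ℂ} {f f' : κ → ℂ → E}
    (h : ∀ i ∈ s, HolDeriv U (f i) (f' i)) :
    HolDeriv U (fun z => ∑ i ∈ s, f i z) (fun z => ∑ i ∈ s, f' i z) := by
  classical
  induction s using Finset.induction_on with
  | empty => simpa using HolDeriv.const U (0 : E)
  | insert i s hi ih =>
    simp only [Finset.sum_insert hi]
    exact (h i (Finset.mem_insert_self i s)).add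
      (ih fun j hj => h j (Finset.mem_insert_of_mem hj))

theorem HolDeriv.comp {U V : Set ℂ} (hU : IsOpen U) (hV : IsOpen V) {f f' : ℂ → E}
    (H : HolDeriv U f f') {u : ℂ → ℂ} (hu : DifferentiableOn ℂ u V) (hm : MapsTo u V U) :
    HolDeriv V (fun z => f (u z)) (fun z => deriv u z • f' (u z)) := by
  obtain ⟨ι, _, g, b, h1, h2, h3⟩ := H
  refine ⟨ι, inferInstance, fun k z => g k (u z), b, fun k => (h1 k).comp hu hm,
    fun z hz => h2 _ (hm hz), fun z hz => ?_⟩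
  simp only [h3 _ (hm hz), Finset.smul_sum, smul_smul]
  refine Finset.sum_congr rfl fun k _ => ?_
  congr 1
  have := deriv_comp (h₂ := g k) (h := u) z ((h1 k).differentiableAt (hU.mem_nhds (hm hz)))
    (hu.differentiableAt (hV.mem_nhds hz))
  rw [mul_comm, ← this]
  rfl

theorem HolDeriv.eqOn_of_eq {U : Set ℂ} (hU : IsOpen U) (hc : IsPreconnected U)
    {f h f' : ℂ → E} (H : HolDeriv U f f') (H' : HolDeriv U h f') {p : ℂ} (hp : p ∈ U)
    (e : f p = h p) {z : ℂ} (hz : z ∈ U) : f z = h z := by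
  obtain ⟨ι, _, g, b, h1, h2, h3⟩ := H
  obtain ⟨ι', _, g', b', h1', h2', h3'⟩ := H'
  refine sub_eq_zero.1 ((Module.forall_dual_apply_eq_zero_iff ℂ _).1 fun ℓ => ?_)
  rw [map_sub, sub_eq_zero]
  have hd : ∀ {κ : Type} [Fintype κ] (g : κ → ℂ → ℂ) (b : κ → E),
      (∀ k, DifferentiableOn ℂ (g k) U) → ∀ z ∈ U, HasDerivAt (fun z => ∑ k, g k z * ℓ (b k))
        (∑ k, deriv (g k) z * ℓ (b k)) z := fun g b hg z hz =>
    HasDerivAt.fun_sum fun k _ =>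
      (((hg k).differentiableAt (hU.mem_nhds hz)).hasDerivAt).mul_const _
  have key := hU.eqOn_of_deriv_eq hc
    (fun z hz => (hd g b h1 z hz).differentiableAt.differentiableWithinAt)
    (fun z hz => (hd g' b' h1' z hz).differentiableAt.differentiableWithinAt)
    (fun z hz => by
      rw [(hd g b h1 z hz).deriv, (hd g' b' h1' z hz).deriv]
      have := congrArg ℓ ((h3 z hz).symm.trans (h3' z hz))
      simpa using this) hp (by
      have := congrArg ℓ ((h2 p hp).symm.trans (e.trans (h2' p hp)))
      simpa using this) hz
  rw [h2 z hz, h2' z hz]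
  simpa using key

end Calculus

section CalculusMul

variable {T : Type*} {𝒜 : Type*} [Ring 𝒜] [Algebra ℂ 𝒜]

theorem TendstoSum.mul {f f' : T → 𝒜} {l : Filter T} {a a' : 𝒜} (h : TendstoSum f l a)
    (h' : TendstoSum f' l a') : TendstoSum (fun t => f t * f' t) l (a * a') := by
  obtain ⟨ι, _, g, c, b, h1, h2, h3⟩ := h
  obtain ⟨ι', _, g', c', b', h1', h2', h3'⟩ := h'
  refine ⟨ι × ι', inferInstance, fun k t => g k.1 t * g' k.2 t, fun k => c k.1 * c' k.2,
    fun k => b k.1 * b' k.2, fun k => (h1 k.1).mul (h1' k.2), ?_, ?_⟩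
  · filter_upwards [h2, h2'] with t e e'
    simp only [e, e', Finset.sum_mul_sum, smul_mul_smul_comm, Fintype.sum_prod_type]
  · simp only [h3, h3', Finset.sum_mul_sum, smul_mul_smul_comm, Fintype.sum_prod_type]

theorem HolDeriv.mul {U : Set ℂ} (hU : IsOpen U) {f f' h h' : ℂ → 𝒜} (H : HolDeriv U f f')
    (H' : HolDeriv U h h') :
    HolDeriv U (fun z => f z * h z) (fun z => f' z * h z + f z * h' z) := by
  obtain ⟨ι, _, g, b, h1, h2, h3⟩ := H
  obtain ⟨ι', _, g', b', h1', h2', h3'⟩ := H'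
  refine ⟨ι × ι', inferInstance, fun k t => g k.1 t * g' k.2 t, fun k => b k.1 * b' k.2,
    fun k => (h1 k.1).mul (h1' k.2), fun z hz => ?_, fun z hz => ?_⟩
  · simp only [h2 z hz, h2' z hz, Finset.sum_mul_sum, smul_mul_smul_comm, Fintype.sum_prod_type]
  · simp only [h2 z hz, h2' z hz, h3 z hz, h3' z hz, Finset.sum_mul_sum, smul_mul_smul_comm,
      Fintype.sum_prod_type, ← Finset.sum_add_distrib, ← add_smul]
    refine Finset.sum_congr rfl fun i _ => Finset.sum_congr rfl fun j _ => ?_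
    congr 1
    exact (deriv_fun_mul ((h1 i).differentiableAt (hU.mem_nhds hz))
      ((h1' j).differentiableAt (hU.mem_nhds hz))).symm

/-- Coefficientwise convergence of power series, each coefficient staying in a finite-dimensional
subspace. -/
def TendstoPS (F : T → PowerSeries 𝒜) (l : Filter T) (ξ : PowerSeries 𝒜) : Prop :=
  ∀ r, TendstoSum (fun t => coeff r (F t)) l (coeff r ξ)

theorem TendstoPS.hasFormalLimit {F : T → PowerSeries 𝒜} {l : Filter T} {ξ : PowerSeries 𝒜}
    (h : TendstoPS F l ξ) : HasFormalLimit F l ξ :=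
  fun p _ r => (h r).tendsto_seminorm p

theorem TendstoPS.unique {F : T → PowerSeries 𝒜} {l : Filter T} [l.NeBot] {ξ ξ' : PowerSeries 𝒜}
    (h : TendstoPS F l ξ) (h' : TendstoPS F l ξ') : ξ = ξ' := by
  ext r
  exact (h r).unique (h' r)

theorem TendstoPS.const (l : Filter T) (ξ : PowerSeries 𝒜) : TendstoPS (fun _ => ξ) l ξ :=
  fun _ => TendstoSum.const _ _

theorem TendstoPS.congr {F F' : T → PowerSeries 𝒜} {l : Filter T} {ξ : PowerSeries 𝒜}
    (h : TendstoPS F l ξ) (hf : ∀ᶠ t in l, F' t = F t) : TendstoPS F' l ξ := fun r =>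
  (h r).congr (hf.mono fun t e => by rw [e])

theorem TendstoPS.comp {S : Type*} {F : T → PowerSeries 𝒜} {l : Filter T} {ξ : PowerSeries 𝒜}
    (h : TendstoPS F l ξ) {u : S → T} {m : Filter S} (hu : Tendsto u m l) :
    TendstoPS (fun s => F (u s)) m ξ := fun r => (h r).comp hu

theorem TendstoPS.add {F F' : T → PowerSeries 𝒜} {l : Filter T} {ξ ξ' : PowerSeries 𝒜}
    (h : TendstoPS F l ξ) (h' : TendstoPS F' l ξ') :
    TendstoPS (fun t => F t + F' t) l (ξ + ξ') := fun r => by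
  simpa only [map_add] using (h r).add (h' r)

theorem TendstoPS.mul {F F' : T → PowerSeries 𝒜} {l : Filter T} {ξ ξ' : PowerSeries 𝒜}
    (h : TendstoPS F l ξ) (h' : TendstoPS F' l ξ') :
    TendstoPS (fun t => F t * F' t) l (ξ * ξ') := fun r => by
  simp only [coeff_mul]
  exact TendstoSum.sum _ fun k _ => (h k.1).mul (h' k.2)

/-- If `Xₜ Rₜ → η` with `Rₜ → 1` and `Rₜ` of constant coefficient `1`, then `Xₜ → η`. -/
theorem TendstoPS.of_mul {F R : T → PowerSeries 𝒜} {l : Filter T} {η : PowerSeries 𝒜}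
    (h : TendstoPS (fun t => F t * R t) l η) (hR : TendstoPS R l 1)
    (hR0 : ∀ t, coeff 0 (R t) = 1) : TendstoPS F l η := by
  intro r
  induction r using Nat.strong_induction_on with
  | _ r ih =>
    have h1 : TendstoSum (fun t => ∑ i ∈ Finset.range r, (-1 : ℂ) • (coeff i (F t) *
        coeff (r - i) (R t))) l (∑ i ∈ Finset.range r, (-1 : ℂ) • (coeff i η * 0)) := by
      refine TendstoSum.sum _ fun i hi => TendstoSum.smul ?_ tendsto_const_nhds
      rw [Finset.mem_range] at hi
      refine (ih i hi).mul ?_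
      have := hR (r - i)
      rwa [coeff_one, if_neg (by omega)] at this
    have h2 := (h r).add h1
    simp only [mul_zero, smul_zero, Finset.sum_const_zero, add_zero] at h2
    refine h2.congr (Eventually.of_forall fun t => ?_)
    simp only [coeff_mul, Finset.Nat.sum_antidiagonal_eq_sum_range_succ_mk,
      Finset.sum_range_succ, neg_smul, one_smul, Finset.sum_neg_distrib, Nat.sub_self, hR0,
      mul_one]
    abel

/-- Coefficientwise holomorphic power series, with derivative. -/
def HolDerivPS (U : Set ℂ) (F F' : ℂ → PowerSeries 𝒜) : Prop :=
  ∀ r, HolDeriv U (fun z => coeff r (F z)) (fun z => coeff r (F' z))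

theorem HolDerivPS.const (U : Set ℂ) (ξ : PowerSeries 𝒜) :
    HolDerivPS U (fun _ => ξ) (fun _ => 0) := fun _ => HolDeriv.const _ _

theorem HolDerivPS.congr {U : Set ℂ} {F F' G G' : ℂ → PowerSeries 𝒜} (H : HolDerivPS U F F')
    (e : ∀ z ∈ U, G z = F z) (e' : ∀ z ∈ U, G' z = F' z) : HolDerivPS U G G' := fun r =>
  (H r).congr (fun z hz => by rw [e z hz]) (fun z hz => by rw [e' z hz])

theorem HolDerivPS.mul {U : Set ℂ} (hU : IsOpen U) {F F' G G' : ℂ → PowerSeries 𝒜}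
    (H : HolDerivPS U F F') (H' : HolDerivPS U G G') :
    HolDerivPS U (fun z => F z * G z) (fun z => F' z * G z + F z * G' z) := fun r => by
  simp only [coeff_mul, map_add, ← Finset.sum_add_distrib]
  exact HolDeriv.sum _ fun k _ => (H k.1).mul hU (H' k.2)

theorem HolDerivPS.comp {U V : Set ℂ} (hU : IsOpen U) (hV : IsOpen V)
    {F F' : ℂ → PowerSeries 𝒜} (H : HolDerivPS U F F') {u : ℂ → ℂ}
    (hu : DifferentiableOn ℂ u V) (hm : MapsTo u V U) :
    HolDerivPS V (fun z => F (u z)) (fun z => deriv u z • F' (u z)) := fun r => by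
  simpa using (H r).comp hU hV hu hm

end CalculusMul

section FormalExp

variable {𝒜 : Type*} [Ring 𝒜] [Algebra ℂ 𝒜]

theorem commute_of_coeff {R : Type*} [Ring R] {F G : PowerSeries R}
    (h : ∀ i j, Commute (coeff i F) (coeff j G)) : Commute F G := by
  ext n
  rw [coeff_mul, coeff_mul, ← Finset.Nat.sum_antidiagonal_swap]
  exact Finset.sum_congr rfl fun k _ => h _ _

theorem coeff_formalExp (n : ℕ) (x : 𝒜) : coeff n (formalExp x) = ((n ! : ℂ)⁻¹) • x ^ n :=
  coeff_mk _ _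

theorem formalExp_zero : formalExp (0 : 𝒜) = 1 := by
  ext n
  rw [coeff_formalExp, coeff_one]
  cases n <;> simp

theorem formalExp_add {x y : 𝒜} (h : Commute x y) :
    formalExp (x + y) = formalExp x * formalExp y := by
  ext n
  rw [coeff_mul, coeff_formalExp, h.add_pow', Finset.smul_sum]
  refine Finset.sum_congr rfl fun k hk => ?_
  rw [coeff_formalExp, coeff_formalExp, smul_mul_smul_comm, ← Nat.cast_smul_eq_nsmul ℂ, smul_smul]
  congr 1
  rw [← Finset.HasAntidiagonal.mem_antidiagonal.1 hk, Nat.cast_add_choose]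
  have := Nat.factorial_ne_zero (k.1 + k.2)
  have := Nat.factorial_ne_zero k.1
  have := Nat.factorial_ne_zero k.2
  field_simp

theorem formalExp_add_smul (x : 𝒜) (a b : ℂ) :
    formalExp ((a + b) • x) = formalExp (a • x) * formalExp (b • x) := by
  rw [add_smul, formalExp_add (((Commute.refl x).smul_left a).smul_right b)]

theorem formalExp_neg_mul (x : 𝒜) (a : ℂ) : formalExp (-a • x) * formalExp (a • x) = 1 := by
  rw [← formalExp_add_smul, neg_add_cancel, zero_smul, formalExp_zero]

theorem formalExp_mul_neg (x : 𝒜) (a : ℂ) : formalExp (a • x) * formalExp (-a • x) = 1 := by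
  rw [← formalExp_add_smul, add_neg_cancel, zero_smul, formalExp_zero]

theorem commute_formalExp {x : 𝒜} {F : PowerSeries 𝒜} (h : ∀ i, Commute x (coeff i F)) :
    Commute (formalExp x) F :=
  commute_of_coeff fun i j => by
    rw [coeff_formalExp]
    exact ((h j).pow_left i).smul_left _

theorem holDerivPS_formalExp {U : Set ℂ} (hU : IsOpen U) {g : ℂ → ℂ}
    (hg : DifferentiableOn ℂ g U) (x : 𝒜) :
    HolDerivPS U (fun z => formalExp (g z • x))
      (fun z => X * (C (deriv g z • x) * formalExp (g z • x))) := by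
  intro r
  cases r with
  | zero =>
    simp only [coeff_formalExp, coeff_zero_X_mul, pow_zero]
    exact HolDeriv.const _ _
  | succ r =>
    simp only [coeff_formalExp, coeff_succ_X_mul, coeff_C_mul, smul_pow]
    refine (HolDeriv.smul_const (g := fun z => (((r + 1)! : ℂ)⁻¹) * g z ^ (r + 1))
      ((hg.pow (r + 1)).const_mul _) (x ^ (r + 1))).congr
      (fun z _ => by rw [smul_smul]) fun z hz => ?_
    have hd := (hg.differentiableAt (hU.mem_nhds hz)).hasDerivAt
    rw [((hd.fun_pow (r + 1)).const_mul _).deriv, smul_smul, smul_mul_smul_comm, ← pow_succ']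
    congr 1
    rw [Nat.factorial_succ]
    have := Nat.factorial_ne_zero r
    have : (r : ℂ) + 1 ≠ 0 := by exact_mod_cast Nat.succ_ne_zero r
    push_cast
    field_simp

theorem tendstoPS_formalExp {T : Type*} {l : Filter T} {g : T → ℂ} {c : ℂ}
    (hg : Tendsto g l (𝓝 c)) (x : 𝒜) :
    TendstoPS (fun t => formalExp (g t • x)) l (formalExp (c • x)) := by
  intro r
  simp only [coeff_formalExp, smul_pow]
  exact ((TendstoSum.const l (x ^ r)).smul (hg.pow r)).smul tendsto_const_nhds

end FormalExp

section Regular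

variable {𝒜 : Type*} [Ring 𝒜] [Algebra ℂ 𝒜]

/-- `f` is on `U` a finite sum `∑ₖ gₖ • bₖ` with `gₖ` holomorphic and `bₖ ∈ S`. -/
def HolSum (S : Subalgebra ℂ 𝒜) (U : Set ℂ) (f : ℂ → 𝒜) : Prop :=
  ∃ (ι : Type) (_ : Fintype ι) (g : ι → ℂ → ℂ) (b : ι → 𝒜),
    (∀ k, DifferentiableOn ℂ (g k) U) ∧ (∀ k, b k ∈ S) ∧ ∀ z ∈ U, f z = ∑ k, g k z • b k

variable {S : Subalgebra ℂ 𝒜} {U : Set ℂ} {f h : ℂ → 𝒜}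

theorem HolSum.const {a : 𝒜} (ha : a ∈ S) : HolSum S U fun _ => a :=
  ⟨Unit, inferInstance, fun _ _ => 1, fun _ => a, fun _ => differentiableOn_const _,
    fun _ => ha, by simp⟩

theorem HolSum.add (H : HolSum S U f) (H' : HolSum S U h) : HolSum S U fun z => f z + h z := by
  obtain ⟨ι, _, g, b, h1, h2, h3⟩ := H
  obtain ⟨ι', _, g', b', h1', h2', h3'⟩ := H'
  refine ⟨ι ⊕ ι', inferInstance, Sum.elim g g', Sum.elim b b', ?_, ?_, fun z hz => ?_⟩
  · rintro (k | k)
    · exact h1 k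
    · exact h1' k
  · rintro (k | k)
    · exact h2 k
    · exact h2' k
  · simp [h3 z hz, h3' z hz]

theorem HolSum.smul (H : HolSum S U f) {u : ℂ → ℂ} (hu : DifferentiableOn ℂ u U) :
    HolSum S U fun z => u z • f z := by
  obtain ⟨ι, _, g, b, h1, h2, h3⟩ := H
  refine ⟨ι, inferInstance, fun k z => u z * g k z, b, fun k => hu.mul (h1 k), h2,
    fun z hz => ?_⟩
  simp only [h3 z hz, Finset.smul_sum, mul_smul]

theorem HolSum.const_mul (H : HolSum S U f) {a : 𝒜} (ha : a ∈ S) :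
    HolSum S U fun z => a * f z := by
  obtain ⟨ι, _, g, b, h1, h2, h3⟩ := H
  refine ⟨ι, inferInstance, g, fun k => a * b k, h1, fun k => S.mul_mem ha (h2 k),
    fun z hz => ?_⟩
  simp only [h3 z hz, Finset.mul_sum, mul_smul_comm]

theorem HolSum.mul_const (H : HolSum S U f) {a : 𝒜} (ha : a ∈ S) :
    HolSum S U fun z => f z * a := by
  obtain ⟨ι, _, g, b, h1, h2, h3⟩ := H
  refine ⟨ι, inferInstance, g, fun k => b k * a, h1, fun k => S.mul_mem (h2 k) ha,
    fun z hz => ?_⟩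
  simp only [h3 z hz, Finset.sum_mul, smul_mul_assoc]

theorem HolSum.mem (H : HolSum S U f) {z : ℂ} (hz : z ∈ U) : f z ∈ S := by
  obtain ⟨ι, _, g, b, h1, h2, h3⟩ := H
  rw [h3 z hz]
  exact S.sum_mem fun k _ => S.smul_mem (h2 k) _

theorem HolSum.tendstoSum (H : HolSum S U f) (hU : IsOpen U) {z : ℂ} (hz : z ∈ U) :
    TendstoSum f (𝓝 z) (f z) := by
  obtain ⟨ι, _, g, b, h1, h2, h3⟩ := H
  refine ⟨ι, inferInstance, g, fun k => g k z, b,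
    fun k => ((h1 k).differentiableAt (hU.mem_nhds hz)).continuousAt, ?_, h3 z hz⟩
  filter_upwards [hU.mem_nhds hz] with w hw using h3 w hw

theorem exists_differentiableOn_hasDerivAt_mul (hU : IsOpen U) (hc : Convex ℝ U)
    (h0 : (0 : ℂ) ∈ U) {g : ℂ → ℂ} (hg : DifferentiableOn ℂ g U) :
    ∃ m : ℂ → ℂ, DifferentiableOn ℂ m U ∧ ∀ z ∈ U, HasDerivAt (fun z => z * m z) (g z) z := by
  obtain ⟨P, hP⟩ := hc.exists_forall_hasDerivWithinAt hg
  refine ⟨dslope P 0, (Complex.differentiableOn_dslope (hU.mem_nhds h0)).2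
    fun z hz => (hP z hz).differentiableWithinAt, fun z hz => ?_⟩
  have e : (fun z => z * dslope P 0 z) = fun z => P z - P 0 := by
    funext z
    simpa using sub_smul_dslope P 0 z
  rw [e]
  exact ((hP z hz).hasDerivAt (hU.mem_nhds hz)).sub_const _

theorem HolSum.exists_primitive (hU : IsOpen U) (hc : Convex ℝ U) (h0 : (0 : ℂ) ∈ U)
    (H : HolSum S U f) : ∃ m : ℂ → 𝒜, HolSum S U m ∧ HolDeriv U (fun z => z • m z) f := by
  obtain ⟨ι, _, g, b, h1, h2, h3⟩ := H
  choose m hm hd using fun k => exists_differentiableOn_hasDerivAt_mul hU hc h0 (h1 k)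
  refine ⟨fun z => ∑ k, m k z • b k, ⟨ι, inferInstance, m, b, hm, h2, fun _ _ => rfl⟩,
    ι, inferInstance, fun k z => z * m k z, b, fun k z hz =>
      (hd k z hz).differentiableAt.differentiableWithinAt, fun z _ => ?_, fun z hz => ?_⟩
  · simp only [Finset.smul_sum, smul_smul]
  · rw [h3 z hz]
    exact Finset.sum_congr rfl fun k _ => by rw [(hd k z hz).deriv]

/-- The half-plane `Re z < 1`. -/
def leftHalf : Set ℂ := {z | z.re < 1}

theorem isOpen_leftHalf : IsOpen leftHalf := isOpen_lt Complex.continuous_re continuous_const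

theorem convex_leftHalf : Convex ℝ leftHalf := convex_halfSpace_re_lt 1

theorem zero_mem_leftHalf : (0 : ℂ) ∈ leftHalf := by simp [leftHalf]

/-- The derivative of coefficient `r + 1` of the regular part of the solution at `0`, in terms of
the quotient `k` by `z` of the nonconstant part of coefficient `r`. -/
def regularStep (A B : 𝒜) (r : ℕ) (k : ℂ → 𝒜) (z : ℂ) : 𝒜 :=
  A * k z - k z * A + (z - 1)⁻¹ • (B * ((if r = 0 then 1 else 0) + z • k z))

theorem HolSum.regularStep {A B : 𝒜} (hA : A ∈ S) (hB : B ∈ S) (r : ℕ) {k : ℂ → 𝒜}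
    (hk : HolSum S leftHalf k) : HolSum S leftHalf (regularStep A B r k) := by
  have hu : DifferentiableOn ℂ (fun z : ℂ => (z - 1)⁻¹) leftHalf := by
    refine DifferentiableOn.inv (by fun_prop) fun z hz e => ?_
    rw [sub_eq_zero.1 e] at hz
    simp [leftHalf] at hz
  have h1 : HolSum S leftHalf fun z => (if r = 0 then (1 : 𝒜) else 0) + z • k z :=
    (HolSum.const (by split_ifs; exacts [S.one_mem, S.zero_mem])).add
      (hk.smul differentiableOn_id)
  have h2 := ((hk.const_mul hA).add ((hk.mul_const hA).smul
    (differentiableOn_const (-1 : ℂ)))).add ((h1.const_mul hB).smul hu)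
  have e : KZ.regularStep A B r k = fun z => A * k z + (-1 : ℂ) • (k z * A) +
      (z - 1)⁻¹ • (B * ((if r = 0 then (1 : 𝒜) else 0) + z • k z)) := by
    funext z
    simp [KZ.regularStep, sub_eq_add_neg]
  rw [e]
  exact h2

theorem left_mem_adjoin (A B : 𝒜) : A ∈ Algebra.adjoin ℂ {A, B} :=
  Algebra.subset_adjoin (by simp)

theorem right_mem_adjoin (A B : 𝒜) : B ∈ Algebra.adjoin ℂ {A, B} :=
  Algebra.subset_adjoin (by simp)

/-- The coefficients of `(H - 1) / z`, for `H` the regular part of the solution at `0`. -/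
def regularAux (A B : 𝒜) : ℕ → {k : ℂ → 𝒜 // HolSum (Algebra.adjoin ℂ {A, B}) leftHalf k}
  | 0 => ⟨fun _ => 0, HolSum.const (Subalgebra.zero_mem _)⟩
  | r + 1 => ⟨_, (((regularAux A B r).2.regularStep (left_mem_adjoin A B) (right_mem_adjoin A B)
      r).exists_primitive isOpen_leftHalf convex_leftHalf zero_mem_leftHalf).choose_spec.1⟩

theorem holDeriv_regularAux (A B : 𝒜) (r : ℕ) :
    HolDeriv leftHalf (fun z => z • (regularAux A B (r + 1)).1 z)
      (regularStep A B r (regularAux A B r).1) :=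
  (((regularAux A B r).2.regularStep (left_mem_adjoin A B) (right_mem_adjoin A B)
      r).exists_primitive isOpen_leftHalf convex_leftHalf zero_mem_leftHalf).choose_spec.2

/-- `(H - 1) / z`, for `H` the regular part of the solution at `0`. -/
def regularQuot (A B : 𝒜) (z : ℂ) : PowerSeries 𝒜 := PowerSeries.mk fun r => (regularAux A B r).1 z

/-- The regular part `H` of the solution `H(z) z^{λA}` of the connection at `0`. -/
def regularPart (A B : 𝒜) (z : ℂ) : PowerSeries 𝒜 := 1 + z • regularQuot A B z

theorem tendstoPS_regularQuot (A B : 𝒜) : TendstoPS (regularQuot A B) (𝓝 0) (regularQuot A B 0) :=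
  fun r => by
    simpa [regularQuot] using
      (regularAux A B r).2.tendstoSum isOpen_leftHalf zero_mem_leftHalf

theorem coeff_zero_regularPart (A B : 𝒜) (z : ℂ) : coeff 0 (regularPart A B z) = 1 := by
  simp only [regularPart, map_add, coeff_smul, regularQuot, coeff_mk, regularAux]
  simp

theorem coeff_regularPart_mem (A B : 𝒜) {z : ℂ} (hz : z ∈ leftHalf) (r : ℕ) :
    coeff r (regularPart A B z) ∈ Algebra.adjoin ℂ {A, B} := by
  simp only [regularPart, map_add, coeff_smul, regularQuot, coeff_mk, coeff_one]
  refine add_mem ?_ (Subalgebra.smul_mem _ ((regularAux A B r).2.mem hz) _)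
  split_ifs
  exacts [one_mem _, zero_mem _]

theorem holDerivPS_regularPart (A B : 𝒜) {V : Set ℂ} (hV : V ⊆ leftHalf) (h0 : (0 : ℂ) ∉ V) :
    HolDerivPS V (regularPart A B) fun z =>
      X * (C (z⁻¹ • A + (z - 1)⁻¹ • B) * regularPart A B z) -
        X * (regularPart A B z * C (z⁻¹ • A)) := by
  intro r
  cases r with
  | zero =>
    refine (HolDeriv.const V (1 : 𝒜)).congr (fun z _ => coeff_zero_regularPart A B z)
      fun z _ => ?_
    rw [map_sub, coeff_zero_X_mul, coeff_zero_X_mul, sub_zero]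
  | succ r =>
    refine ((holDeriv_regularAux A B r).mono hV).congr (fun z _ => ?_) fun z hz => ?_
    · simp [regularPart, regularQuot, coeff_one]
    · have hz0 : z ≠ 0 := fun e => h0 (e ▸ hz)
      rw [map_sub, coeff_succ_X_mul, coeff_succ_X_mul, coeff_C_mul, coeff_mul_C]
      simp only [regularPart, regularQuot, regularStep, map_add, coeff_smul, coeff_mk, coeff_one]
      generalize (regularAux A B r).1 z = k
      have hu : (if r = 0 then (1 : 𝒜) else 0) * A = A * (if r = 0 then (1 : 𝒜) else 0) := by
        split_ifs <;> simp
      generalize (if r = 0 then (1 : 𝒜) else 0) = u at hu ⊢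
      simp only [add_mul, mul_add, smul_mul_assoc, mul_smul_comm, smul_add, smul_smul,
        inv_mul_cancel₀ hz0, mul_inv_cancel₀ hz0, one_smul, hu,
        mul_comm (z - 1)⁻¹ z]
      abel

/-- The solution `H(z) z^{λA}` of the connection normalized at `0`. -/
def solution (A B : 𝒜) (z : ℂ) : PowerSeries 𝒜 :=
  regularPart A B z * formalExp (Complex.log z • A)

/-- `F` solves `dF/dz = λ (A / z + B / (z - 1)) F` on `U`. -/
def IsKZSolution (U : Set ℂ) (A B : 𝒜) (F : ℂ → PowerSeries 𝒜) : Prop :=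
  HolDerivPS U F fun z => X * (C (z⁻¹ • A + (z - 1)⁻¹ • B) * F z)

theorem IsKZSolution.mul_const {U : Set ℂ} (hU : IsOpen U) {A B : 𝒜} {F : ℂ → PowerSeries 𝒜}
    (hF : IsKZSolution U A B F) (ξ : PowerSeries 𝒜) : IsKZSolution U A B fun z => F z * ξ :=
  (HolDerivPS.mul hU hF (HolDerivPS.const U ξ)).congr (fun _ _ => rfl)
    fun z _ => by simp only [mul_zero, add_zero, mul_assoc]

theorem IsKZSolution.eqOn {U : Set ℂ} (hU : IsOpen U) (hc : IsPreconnected U) {A B : 𝒜}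
    {F G : ℂ → PowerSeries 𝒜} (hF : IsKZSolution U A B F) (hG : IsKZSolution U A B G)
    {p : ℂ} (hp : p ∈ U) (e : F p = G p) : ∀ z ∈ U, F z = G z := by
  have key : ∀ r, ∀ z ∈ U, coeff r (F z) = coeff r (G z) := by
    intro r
    induction r with
    | zero =>
      intro z hz
      refine (hF 0).eqOn_of_eq hU hc ((hG 0).congr (fun _ _ => rfl) fun w _ => ?_) hp
        (by rw [e]) hz
      rw [coeff_zero_X_mul, coeff_zero_X_mul]
    | succ r ih =>
      intro z hz
      refine (hF (r + 1)).eqOn_of_eq hU hc ((hG (r + 1)).congr (fun _ _ => rfl) fun w hw => ?_) hp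
        (by rw [e]) hz
      rw [coeff_succ_X_mul, coeff_succ_X_mul, coeff_C_mul, coeff_C_mul, ih w hw]
  intro z hz
  ext r
  exact key r z hz

theorem coeff_zero_solution (A B : 𝒜) (z : ℂ) : coeff 0 (solution A B z) = 1 := by
  simp [solution, coeff_mul, coeff_zero_regularPart, coeff_formalExp]

theorem exists_inverse {R : Type*} [Ring R] {F : PowerSeries R} (h : coeff 0 F = 1) : ∃ G, F * G = 1 ∧ G * F = 1 :=
  ⟨invOfUnit F 1, mul_invOfUnit F 1 (by simpa using h), invOfUnit_mul F 1 (by simpa using h)⟩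

theorem isKZSolution_solution (A B : 𝒜) {V : Set ℂ} (hV : IsOpen V) (h1 : V ⊆ leftHalf)
    (h0 : V ⊆ Complex.slitPlane) : IsKZSolution V A B (solution A B) := by
  have hlog : DifferentiableOn ℂ Complex.log V := fun z hz =>
    (Complex.differentiableAt_log (h0 hz)).differentiableWithinAt
  refine ((holDerivPS_regularPart A B h1 fun h => Complex.zero_notMem_slitPlane (h0 h)).mul hV
    (holDerivPS_formalExp hV hlog A)).congr (fun _ _ => rfl) fun z hz => ?_
  rw [(Complex.hasDerivAt_log (h0 hz)).deriv, solution]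
  have hX := commute_X (regularPart A B z)
  rw [← mul_assoc (regularPart A B z) X, hX.eq]
  simp only [sub_mul, mul_assoc]
  abel

theorem commute_solution {A B Λ : 𝒜} (hA : Commute Λ A) (hB : Commute Λ B) {z : ℂ}
    (hz : z ∈ leftHalf) (i : ℕ) : Commute Λ (coeff i (solution A B z)) := by
  have hS : Algebra.adjoin ℂ {A, B} ≤ Subalgebra.centralizer ℂ {Λ} := by
    refine Algebra.adjoin_le ?_
    rintro x (rfl | rfl)
    · exact (Subalgebra.mem_centralizer_iff ℂ).2 (by rintro _ rfl; exact hA.eq)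
    · exact (Subalgebra.mem_centralizer_iff ℂ).2 (by rintro _ rfl; exact hB.eq)
  rw [solution, coeff_mul]
  refine Commute.sum_right _ _ _ fun k _ => Commute.mul_right ?_ ?_
  · exact (Subalgebra.mem_centralizer_iff ℂ).1 (hS (coeff_regularPart_mem A B hz k.1)) Λ rfl
  · rw [coeff_formalExp]
    exact ((hA.smul_right _).pow_right _).smul_right _

end Regular

section Limits

theorem tendsto_mul_log_pow (m : ℕ) :
    Tendsto (fun w : ℂ => w * Complex.log w ^ m) (𝓝 0) (𝓝 0) := by
  set t : ℝ := ((m : ℝ) + 1)⁻¹ with ht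
  have htpos : 0 < t := by positivity
  have hlim : Tendsto (fun w : ℂ => ‖w‖ ^ t * (1 / t + Real.pi) ^ m) (𝓝 0) (𝓝 0) := by
    have h1 : Continuous fun w : ℂ => ‖w‖ ^ t * (1 / t + Real.pi) ^ m :=
      (continuous_norm.rpow_const fun _ => Or.inr htpos.le).mul continuous_const
    simpa [Real.zero_rpow htpos.ne'] using h1.tendsto 0
  refine squeeze_zero_norm' ?_ hlim
  filter_upwards [Metric.ball_mem_nhds (0 : ℂ) one_pos] with w hw
  rw [mem_ball_zero_iff] at hw
  rcases eq_or_ne w 0 with rfl | hw0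
  · simp [Real.zero_rpow htpos.ne']
  have hx : 0 < ‖w‖ := norm_pos_iff.2 hw0
  have hxt : ‖w‖ ^ t ≤ 1 := Real.rpow_le_one hx.le hw.le htpos.le
  have hlog : ‖Complex.log w‖ ≤ |Real.log ‖w‖| + Real.pi := by
    refine (Complex.norm_le_abs_re_add_abs_im _).trans ?_
    rw [Complex.log_re, Complex.log_im]
    exact add_le_add le_rfl (Complex.abs_arg_le_pi w)
  have hbd : ‖w‖ ^ t * ‖Complex.log w‖ ≤ 1 / t + Real.pi := by
    have h1 := (Real.abs_log_mul_self_rpow_lt ‖w‖ t hx hw.le htpos).le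
    rw [abs_mul, abs_of_pos (Real.rpow_pos_of_pos hx t)] at h1
    have h2 := mul_le_mul_of_nonneg_left hlog (Real.rpow_nonneg hx.le t)
    nlinarith [Real.pi_pos]
  have hsplit : ‖w‖ = ‖w‖ ^ t * (‖w‖ ^ t) ^ m := by
    rw [← Real.rpow_natCast, ← Real.rpow_mul hx.le, ← Real.rpow_add hx]
    have : t + t * m = 1 := by rw [ht]; field_simp; ring
    rw [this, Real.rpow_one]
  rw [norm_mul, norm_pow]
  calc ‖w‖ * ‖Complex.log w‖ ^ m = ‖w‖ ^ t * (‖w‖ ^ t * ‖Complex.log w‖) ^ m := by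
        rw [mul_pow, ← mul_assoc, ← hsplit]
    _ ≤ _ := mul_le_mul_of_nonneg_left (pow_le_pow_left₀ (by positivity) hbd m)
        (Real.rpow_nonneg hx.le t)

variable {𝒜 : Type*} [Ring 𝒜] [Algebra ℂ 𝒜]

theorem tendstoPS_conj {T : Type*} {l : Filter T} {K : T → PowerSeries 𝒜} {ξ : PowerSeries 𝒜}
    (hK : TendstoPS K l ξ) {u L : T → ℂ} (hu : ∀ m : ℕ, Tendsto (fun t => u t * L t ^ m) l (𝓝 0))
    (A : 𝒜) :
    TendstoPS (fun t => formalExp (-L t • A) * (1 + u t • K t) * formalExp (L t • A)) l 1 := by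
  have h0 : TendstoPS (fun t => u t • (formalExp (-L t • A) * K t * formalExp (L t • A))) l 0 := by
    intro r
    have h1 : TendstoSum (fun t => ∑ k ∈ Finset.HasAntidiagonal.antidiagonal r,
        ∑ j ∈ Finset.HasAntidiagonal.antidiagonal k.1,
          (u t * L t ^ (j.1 + k.2)) • (((((j.1)! : ℂ)⁻¹ * (-1) ^ j.1) • A ^ j.1 *
            coeff j.2 (K t)) * ((((k.2)! : ℂ)⁻¹) • A ^ k.2))) l
        (∑ k ∈ Finset.HasAntidiagonal.antidiagonal r,
        ∑ j ∈ Finset.HasAntidiagonal.antidiagonal k.1,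
          (0 : ℂ) • (((((j.1)! : ℂ)⁻¹ * (-1) ^ j.1) • A ^ j.1 *
            coeff j.2 ξ) * ((((k.2)! : ℂ)⁻¹) • A ^ k.2))) :=
      TendstoSum.sum _ fun k _ => TendstoSum.sum _ fun j _ => TendstoSum.smul
        (((TendstoSum.const _ _).mul (hK _)).mul (TendstoSum.const _ _)) (hu _)
    simp only [zero_smul, Finset.sum_const_zero] at h1
    rw [map_zero]
    refine h1.congr (Eventually.of_forall fun t => ?_)
    simp only [coeff_smul, coeff_mul, Finset.smul_sum, Finset.sum_mul, coeff_formalExp]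
    refine Finset.sum_congr rfl fun k _ => Finset.sum_congr rfl fun j _ => ?_
    rw [smul_pow, smul_pow, neg_pow]
    simp only [smul_mul_assoc, mul_smul_comm, smul_smul]
    congr 1
    ring
  have h1 := (TendstoPS.const l (1 : PowerSeries 𝒜)).add h0
  rw [add_zero] at h1
  refine h1.congr (Eventually.of_forall fun t => ?_)
  rw [mul_add, add_mul, mul_one, formalExp_neg_mul, mul_smul_comm, smul_mul_assoc]

theorem tendstoPS_conj_regularPart {T : Type*} {l : Filter T} (A B X : 𝒜) {u L : T → ℂ}
    (hu : ∀ m : ℕ, Tendsto (fun t => u t * L t ^ m) l (𝓝 0)) :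
    TendstoPS (fun t => formalExp (-L t • X) * regularPart A B (u t) * formalExp (L t • X)) l 1 :=
  tendstoPS_conj ((tendstoPS_regularQuot A B).comp (by simpa using hu 0)) hu X

end Limits

section Transport

variable {𝒜 : Type*} [Ring 𝒜] [Algebra ℂ 𝒜]

/-- The strip `0 < Re z < 1`. -/
def strip : Set ℂ := {z | 0 < z.re} ∩ leftHalf

theorem isOpen_strip : IsOpen strip :=
  (isOpen_lt continuous_const Complex.continuous_re).inter isOpen_leftHalf

theorem isPreconnected_strip : IsPreconnected strip :=
  ((convex_halfSpace_re_gt 0).inter convex_leftHalf).isPreconnected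

theorem strip_subset_slitPlane : strip ⊆ Complex.slitPlane := fun _ hz => Or.inl hz.1

theorem smul_X_mul_C_mul (x : ℂ) (M : 𝒜) (F : PowerSeries 𝒜) :
    x • (X * (C M * F)) = X * (C (x • M) * F) := by
  ext r
  cases r with
  | zero => rw [coeff_smul, coeff_zero_X_mul, coeff_zero_X_mul, smul_zero]
  | succ r =>
    rw [coeff_smul, coeff_succ_X_mul, coeff_succ_X_mul, coeff_C_mul, coeff_C_mul, smul_mul_assoc]

theorem hasDerivAt_affinePath (δ ε s : ℝ) :
    HasDerivAt (affinePath δ ε) (1 - ε - δ : ℂ) s := by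
  have h : HasDerivAt (fun s : ℝ => (s : ℂ)) 1 s := Complex.ofRealCLM.hasDerivAt
  exact (((h.const_sub 1).mul_const (δ : ℂ)).add (h.mul_const (1 - ε : ℂ))).congr_deriv (by ring)

theorem affinePath_mem_strip {δ ε : ℝ} (hδ : δ ∈ Ioc (0 : ℝ) (1 / 4))
    (hε : ε ∈ Ioc (0 : ℝ) (1 / 4)) {s : ℝ} (hs : s ∈ Icc (0 : ℝ) 1) :
    affinePath δ ε s ∈ strip := by
  have hre : affinePath δ ε s = (((1 - s) * δ + s * (1 - ε) : ℝ) : ℂ) := by simp [affinePath]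
  obtain ⟨hδ0, hδ1⟩ := hδ
  obtain ⟨hε0, hε1⟩ := hε
  obtain ⟨hs0, hs1⟩ := hs
  rw [hre]
  constructor
  · simp only [mem_ofPred_eq, Complex.ofReal_re]
    nlinarith
  · simp only [leftHalf, mem_ofPred_eq, Complex.ofReal_re]
    nlinarith

theorem IsKZSolution.isFundamentalSolution {A B : 𝒜} {F : ℂ → PowerSeries 𝒜}
    (hF : IsKZSolution strip A B F) {δ ε : ℝ} (hδ : δ ∈ Ioc (0 : ℝ) (1 / 4))
    (hε : ε ∈ Ioc (0 : ℝ) (1 / 4)) (h1 : F δ = 1) :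
    IsFundamentalSolution (connectionCoeff (affinePath δ ε)) ![A, B]
      (fun s => F (affinePath δ ε s)) := by
  constructor
  · simpa [affinePath] using h1
  · intro r
    obtain ⟨ι, _, g, b, hg, hf, hf'⟩ := hF r
    beta_reduce at hf hf'
    let e := Fintype.equivFin ι
    have hmem := fun s (hs : s ∈ Icc (0 : ℝ) 1) => affinePath_mem_strip hδ hε hs
    have hc : ContDiff ℝ ∞ (affinePath δ ε) := by
      have : ContDiff ℝ ∞ (fun s : ℝ => (s : ℂ)) := Complex.ofRealCLM.contDiff
      unfold affinePath
      fun_prop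
    refine ⟨Fintype.card ι, fun k s => g (e.symm k) (affinePath δ ε s), fun k => b (e.symm k),
      fun k => ?_, fun s hs => ?_, fun s hs => ?_⟩
    · exact (((hg _).contDiffOn isOpen_strip).restrict_scalars ℝ).comp hc.contDiffOn hmem
    · rw [hf _ (hmem s hs)]
      exact (e.symm.sum_comp fun k => g k (affinePath δ ε s) • b k).symm
    · have hd : ∀ k, derivWithin (fun s => g k (affinePath δ ε s)) (Icc 0 1) s =
          (1 - ε - δ : ℂ) * deriv (g k) (affinePath δ ε s) := by
        intro k
        have h2 := ((hg k).differentiableAt (isOpen_strip.mem_nhds (hmem s hs))).hasDerivAt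
        rw [mul_comm]
        exact ((h2.comp s (hasDerivAt_affinePath δ ε s)).hasDerivWithinAt).derivWithin
          (uniqueDiffOn_Icc zero_lt_one s hs)
      rw [e.symm.sum_comp fun k =>
        derivWithin (fun s => g k (affinePath δ ε s)) (Icc 0 1) s • b k]
      simp only [hd, mul_smul, ← Finset.smul_sum]
      rw [← hf' _ (hmem s hs), ← coeff_smul, smul_X_mul_C_mul]
      simp [connectionCoeff, (hasDerivAt_affinePath δ ε s).deriv, smul_smul, div_eq_mul_inv]

theorem parallelTransport_mul_solution (A B : 𝒜) {δ ε : ℝ} (hδ : δ ∈ Ioc (0 : ℝ) (1 / 4))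
    (hε : ε ∈ Ioc (0 : ℝ) (1 / 4)) :
    parallelTransport A B (affinePath δ ε) * solution A B δ = solution A B (1 - ε) := by
  obtain ⟨V, hV, hV'⟩ := exists_inverse (coeff_zero_solution A B δ)
  have hF := (isKZSolution_solution A B isOpen_strip (fun _ h => h.2)
    strip_subset_slitPlane).mul_const isOpen_strip V
  have h1 := (isFundamentalSolution_fundamentalSolution
    (contDiffOn_connectionCoeff_affinePath hδ hε) ![A, B]).unique
    (hF.isFundamentalSolution hδ hε hV) (right_mem_Icc.2 zero_le_one)
  rw [parallelTransport, h1, mul_assoc, hV', mul_one]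
  simp [affinePath]

theorem isKZSolution_solution_one_sub (A B : 𝒜) {V : Set ℂ} (hV : IsOpen V)
    (h : ∀ z ∈ V, 0 < z.re) (h' : ∀ z ∈ V, 1 - z ∈ Complex.slitPlane) :
    IsKZSolution V A B fun z => solution B A (1 - z) := by
  have hs := isKZSolution_solution B A (isOpen_leftHalf.inter Complex.isOpen_slitPlane)
    inter_subset_left inter_subset_right
  refine (HolDerivPS.comp (isOpen_leftHalf.inter Complex.isOpen_slitPlane) hV hs
    (u := fun z => 1 - z) (by fun_prop) fun z hz => ⟨?_, h' z hz⟩).congr (fun _ _ => rfl)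
    fun z hz => ?_
  · simpa [leftHalf] using h z hz
  · have hd : deriv (fun z : ℂ => 1 - z) z = -1 := ((hasDerivAt_id z).const_sub 1).deriv
    rw [hd, smul_X_mul_C_mul]
    have e1 : (1 - z - 1)⁻¹ = -z⁻¹ := by rw [← inv_neg]; congr 1; ring
    have e2 : (1 - z)⁻¹ = -(z - 1)⁻¹ := by rw [← inv_neg]; congr 1; ring
    rw [e1, e2]
    congr 3
    simp only [neg_smul, smul_add, smul_neg, one_smul, neg_neg]
    abel

theorem exists_solution_eq_mul (A B : 𝒜) :
    ∃ Φ : PowerSeries 𝒜, ∀ z ∈ strip, solution A B z = solution B A (1 - z) * Φ := by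
  obtain ⟨V, hV, -⟩ := exists_inverse (coeff_zero_solution B A (1 - (1 / 2 : ℂ)))
  refine ⟨V * solution A B (1 / 2), ?_⟩
  have h1 := isKZSolution_solution A B isOpen_strip (fun _ h => h.2) strip_subset_slitPlane
  have h2 := (isKZSolution_solution_one_sub A B isOpen_strip (fun _ h => h.1)
    fun z hz => Or.inl (by simpa [leftHalf] using hz.2)).mul_const isOpen_strip
      (V * solution A B (1 / 2))
  refine h1.eqOn isOpen_strip isPreconnected_strip h2 (p := 1 / 2) ?_ ?_
  · constructor <;> norm_num [leftHalf]
  · rw [← mul_assoc, hV, one_mul]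

theorem coeff_zero_conj_regularPart (A B X : 𝒜) (z x y : ℂ) :
    coeff 0 (formalExp (x • X) * regularPart A B z * formalExp (y • X)) = 1 := by
  simp [coeff_mul, coeff_zero_regularPart, coeff_formalExp]

theorem isDrinfeldAssociator_of_solution_eq {A B : 𝒜} {Φ : PowerSeries 𝒜}
    (h : ∀ z ∈ strip, solution A B z = solution B A (1 - z) * Φ) :
    IsDrinfeldAssociator A B Φ := by
  refine TendstoPS.hasFormalLimit ?_
  set l : Filter (ℝ × ℝ) := 𝓝[Ioc (0 : ℝ) (1 / 4) ×ˢ Ioc (0 : ℝ) (1 / 4)] (0, 0) with hl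
  have h1 : Tendsto (fun q : ℝ × ℝ => (q.1 : ℂ)) l (𝓝 0) := by
    have : Continuous fun q : ℝ × ℝ => (q.1 : ℂ) := by fun_prop
    simpa using (this.tendsto (0, 0)).mono_left nhdsWithin_le_nhds
  have h2 : Tendsto (fun q : ℝ × ℝ => (q.2 : ℂ)) l (𝓝 0) := by
    have : Continuous fun q : ℝ × ℝ => (q.2 : ℂ) := by fun_prop
    simpa using (this.tendsto (0, 0)).mono_left nhdsWithin_le_nhds
  have hR := tendstoPS_conj_regularPart (l := l) A B A (u := fun q => (q.1 : ℂ))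
    (L := fun q => Complex.log q.1) fun m => (tendsto_mul_log_pow m).comp h1
  have hS := (tendstoPS_conj_regularPart (l := l) B A B (u := fun q => (q.2 : ℂ))
    (L := fun q => Complex.log q.2) fun m => (tendsto_mul_log_pow m).comp h2).mul
    (TendstoPS.const l Φ)
  rw [one_mul] at hS
  refine TendstoPS.of_mul (hS.congr ?_) hR fun q => coeff_zero_conj_regularPart _ _ _ _ _ _
  filter_upwards [self_mem_nhdsWithin] with q hq
  obtain ⟨hδ, hε⟩ := hq
  have hW := parallelTransport_mul_solution A B hδ hε
  have hz : (1 - q.2 : ℂ) ∈ strip := by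
    have := affinePath_mem_strip hδ hε (right_mem_Icc.2 zero_le_one)
    simpa [affinePath] using this
  rw [h _ hz, sub_sub_cancel] at hW
  have hE := formalExp_mul_neg A (Complex.log q.1)
  rw [regularizedTransport, Complex.ofReal_log hδ.1.le, Complex.ofReal_log hε.1.le]
  calc _ = formalExp (-Complex.log q.2 • B) * parallelTransport A B (affinePath q.1 q.2) *
        ((formalExp (Complex.log q.1 • A) * formalExp (-Complex.log q.1 • A)) *
          solution A B q.1) := by simp only [solution, mul_assoc]
    _ = formalExp (-Complex.log q.2 • B) *
        (parallelTransport A B (affinePath q.1 q.2) * solution A B q.1) := by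
      rw [hE, one_mul, mul_assoc]
    _ = _ := by rw [hW]; simp only [solution, mul_assoc]

theorem isDrinfeldAssociator_drinfeldAssociator (A B : 𝒜) :
    IsDrinfeldAssociator A B (drinfeldAssociator A B) := by
  have h : ∃ Φ, IsDrinfeldAssociator A B Φ :=
    (exists_solution_eq_mul A B).imp fun _ => isDrinfeldAssociator_of_solution_eq
  rw [drinfeldAssociator, dif_pos h]
  exact h.choose_spec

theorem solution_eq_mul_drinfeldAssociator (A B : 𝒜) {z : ℂ} (hz : z ∈ strip) :
    solution A B z = solution B A (1 - z) * drinfeldAssociator A B := by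
  obtain ⟨Φ, h⟩ := exists_solution_eq_mul A B
  rw [(isDrinfeldAssociator_drinfeldAssociator A B).unique (isDrinfeldAssociator_of_solution_eq h)]
  exact h z hz

end Transport

section Hexagon

variable {𝒜 : Type*} [Ring 𝒜] [Algebra ℂ 𝒜]

/-- The quadrant `Re z > 0`, `Im z < 0`. -/
def lowerQuadrant : Set ℂ := {z | 0 < z.re} ∩ {z | z.im < 0}

theorem isOpen_lowerQuadrant : IsOpen lowerQuadrant :=
  (isOpen_lt continuous_const Complex.continuous_re).inter
    (isOpen_lt Complex.continuous_im continuous_const)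

theorem isPreconnected_lowerQuadrant : IsPreconnected lowerQuadrant :=
  ((convex_halfSpace_re_gt 0).inter (convex_halfSpace_im_lt 0)).isPreconnected

theorem ne_zero_of_mem_lowerQuadrant {z : ℂ} (hz : z ∈ lowerQuadrant) : z ≠ 0 := by
  rintro rfl
  simpa using hz.1

theorem sub_one_ne_zero_of_mem_lowerQuadrant {z : ℂ} (hz : z ∈ lowerQuadrant) : z - 1 ≠ 0 := by
  intro h
  have := hz.2
  rw [mem_ofPred_eq, sub_eq_zero.1 h] at this
  simp at this

theorem one_sub_inv_mem {z : ℂ} (hz : z ∈ lowerQuadrant) :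
    1 - z⁻¹ ∈ leftHalf ∩ Complex.slitPlane := by
  have hn : 0 < Complex.normSq z := Complex.normSq_pos.2 (ne_zero_of_mem_lowerQuadrant hz)
  constructor
  · simpa [leftHalf] using div_pos hz.1 hn
  · refine Or.inr ?_
    simp only [Complex.sub_im, Complex.one_im, Complex.inv_im, zero_sub, neg_div, neg_neg]
    exact div_ne_zero (ne_of_lt hz.2) hn.ne'

theorem isKZSolution_solution_one_sub_inv {A B C' Λ : 𝒜} (hΛ : Λ = A + B + C')
    (hB : Commute Λ B) (hC : Commute Λ C') :
    IsKZSolution lowerQuadrant A B fun z =>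
      formalExp (Complex.log z • Λ) * solution B C' (1 - z⁻¹) := by
  have hU := isOpen_leftHalf.inter Complex.isOpen_slitPlane
  have hs := isKZSolution_solution B C' hU inter_subset_left inter_subset_right
  have hsl : lowerQuadrant ⊆ Complex.slitPlane := fun z hz => Or.inl hz.1
  have hinv : DifferentiableOn ℂ (fun z : ℂ => 1 - z⁻¹) lowerQuadrant :=
    (differentiableOn_inv.mono fun z hz => ne_zero_of_mem_lowerQuadrant hz).const_sub 1
  have hlog : DifferentiableOn ℂ Complex.log lowerQuadrant := fun z hz =>
    (Complex.differentiableAt_log (hsl hz)).differentiableWithinAt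
  refine ((holDerivPS_formalExp isOpen_lowerQuadrant hlog Λ).mul isOpen_lowerQuadrant
    (HolDerivPS.comp hU isOpen_lowerQuadrant hs hinv fun z hz => one_sub_inv_mem hz)).congr
    (fun _ _ => rfl) fun z hz => ?_
  have hz0 := ne_zero_of_mem_lowerQuadrant hz
  have hz1 := sub_one_ne_zero_of_mem_lowerQuadrant hz
  have hd : deriv (fun z : ℂ => 1 - z⁻¹) z = (z ^ 2)⁻¹ := by
    rw [((hasDerivAt_inv hz0).const_sub 1).deriv, neg_neg]
  rw [(Complex.hasDerivAt_log (hsl hz)).deriv, hd, smul_X_mul_C_mul]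
  set M := (z ^ 2)⁻¹ • ((1 - z⁻¹)⁻¹ • B + (1 - z⁻¹ - 1)⁻¹ • C') with hM
  have hcomm : Commute (formalExp (Complex.log z • Λ)) (X * C M) := by
    refine (commute_X _).mul_right (commute_formalExp fun i => ?_)
    rw [coeff_C]
    split_ifs
    · exact (((hB.smul_right _).add_right (hC.smul_right _)).smul_right _).smul_left _
    · exact Commute.zero_right _
  have hsum : z⁻¹ • A + (z - 1)⁻¹ • B = z⁻¹ • Λ + M := by
    have e1 : (z ^ 2)⁻¹ * (1 - z⁻¹)⁻¹ = (z - 1)⁻¹ - z⁻¹ := by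
      have : 1 - z⁻¹ = (z - 1) / z := by field_simp
      rw [this]
      field_simp
      ring
    have e2 : (z ^ 2)⁻¹ * (1 - z⁻¹ - 1)⁻¹ = -z⁻¹ := by
      have : 1 - z⁻¹ - 1 = -z⁻¹ := by ring
      rw [this]
      field_simp
    rw [hM, smul_add, smul_smul, smul_smul, e1, e2, hΛ, sub_smul, neg_smul, smul_add, smul_add]
    abel
  beta_reduce
  rw [hsum, map_add, add_mul, mul_add, ← mul_assoc X (C M) (solution _ _ _),
    ← mul_assoc _ (X * C M), hcomm.eq]
  simp only [mul_assoc]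

theorem log_one_sub_inv {z : ℂ} (hz : z ∈ lowerQuadrant) :
    Complex.log (1 - z⁻¹) = Complex.log (1 - z) + -(Real.pi * Complex.I) + -Complex.log z := by
  have hz0 := ne_zero_of_mem_lowerQuadrant hz
  have hz1 : 1 - z ≠ 0 := by
    rw [← neg_sub]
    exact neg_ne_zero.2 (sub_one_ne_zero_of_mem_lowerQuadrant hz)
  have h1 : 0 ≤ (1 - z).arg := by
    rw [Complex.arg_nonneg_iff]
    simpa using hz.2.le
  have h2 : z.arg < 0 := Complex.arg_neg_iff.2 hz.2
  have h3 := (1 - z).arg_le_pi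
  have h4 := z.neg_pi_lt_arg
  rw [← Complex.log_exp (x := Complex.log (1 - z) + -(Real.pi * Complex.I) + -Complex.log z)]
  · rw [Complex.exp_add, Complex.exp_add, Complex.exp_neg, Complex.exp_neg, Complex.exp_log hz0,
      Complex.exp_log hz1, Complex.exp_pi_mul_I]
    congr 1
    field_simp
    ring
  · simp [Complex.log_im]
    linarith
  · simp [Complex.log_im]
    linarith

theorem formalExp_log_mul_solution {A B C' Λ : 𝒜} (hΛ : Λ = A + B + C')
    (hB : Commute Λ B) (hC : Commute Λ C') {z : ℂ} (hz : z ∈ lowerQuadrant) :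
    formalExp (Complex.log z • Λ) * solution B C' (1 - z⁻¹) =
      solution B A (1 - z) * formalExp (-(Real.pi * Complex.I : ℂ) • B) := by
  obtain ⟨V, hV, -⟩ := exists_inverse (coeff_zero_solution B A (1 - (1 - Complex.I)))
  set p : ℂ := 1 - Complex.I with hp
  have hpQ : p ∈ lowerQuadrant := by constructor <;> simp [hp]
  set K := V * (formalExp (Complex.log p • Λ) * solution B C' (1 - p⁻¹)) with hK
  have hG := isKZSolution_solution_one_sub A B isOpen_lowerQuadrant (fun z hz => hz.1)
    fun z hz => Or.inr (by simpa using ne_of_lt hz.2)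
  have heq : ∀ z ∈ lowerQuadrant, formalExp (Complex.log z • Λ) * solution B C' (1 - z⁻¹) =
      solution B A (1 - z) * K :=
    (isKZSolution_solution_one_sub_inv hΛ hB hC).eqOn isOpen_lowerQuadrant
      isPreconnected_lowerQuadrant (hG.mul_const isOpen_lowerQuadrant K) hpQ
      (by rw [hK, ← mul_assoc, hV, one_mul])
  suffices hKe : K = formalExp (-(Real.pi * Complex.I : ℂ) • B) by rw [heq z hz, hKe]
  have hpath : Tendsto (fun t : ℝ => 1 - (t : ℂ) * Complex.I) (𝓝[>] 0) (𝓝 1) := by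
    have : Continuous fun t : ℝ => 1 - (t : ℂ) * Complex.I := by fun_prop
    simpa using (this.tendsto 0).mono_left nhdsWithin_le_nhds
  have hmem : ∀ᶠ t : ℝ in 𝓝[>] 0, 1 - (t : ℂ) * Complex.I ∈ lowerQuadrant := by
    filter_upwards [self_mem_nhdsWithin] with t ht
    have : (0 : ℝ) < t := ht
    constructor <;> simp [this]
  have hsub : Tendsto (fun t : ℝ => 1 - (1 - (t : ℂ) * Complex.I)) (𝓝[>] 0) (𝓝 0) := by
    simpa using hpath.const_sub 1
  have hinv := hpath.inv₀ one_ne_zero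
  have hlog : Tendsto (fun t : ℝ => Complex.log (1 - (t : ℂ) * Complex.I)) (𝓝[>] 0) (𝓝 0) := by
    simpa using hpath.clog (by simp)
  set ζ : ℝ → ℂ := fun t => 1 - (t : ℂ) * Complex.I
  have hR := tendstoPS_conj_regularPart (l := 𝓝[>] (0 : ℝ)) B A B (u := fun t => 1 - ζ t)
    (L := fun t => Complex.log (1 - ζ t)) fun m => (tendsto_mul_log_pow m).comp hsub
  have hS := tendstoPS_conj_regularPart (l := 𝓝[>] (0 : ℝ)) B C' B (u := fun t => 1 - (ζ t)⁻¹)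
    (L := fun t => Complex.log (1 - ζ t)) fun m => by
      have h1 := hinv.neg.mul ((tendsto_mul_log_pow m).comp hsub)
      rw [mul_zero] at h1
      refine h1.congr' ?_
      filter_upwards [hmem] with t ht
      have : ζ t ≠ 0 := ne_zero_of_mem_lowerQuadrant ht
      change -(ζ t)⁻¹ * ((1 - ζ t) * Complex.log (1 - ζ t) ^ m) =
        (1 - (ζ t)⁻¹) * Complex.log (1 - ζ t) ^ m
      rw [← mul_assoc]
      congr 1
      field_simp
      ring
  have hE := tendstoPS_formalExp hlog Λ
  have hE' := tendstoPS_formalExp (by simpa using hlog.neg :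
    Tendsto (fun t => -Complex.log (ζ t)) (𝓝[>] (0 : ℝ)) (𝓝 0)) B
  rw [zero_smul, formalExp_zero] at hE hE'
  have hL := (hE.mul hS).mul ((TendstoPS.const _
    (formalExp (-(Real.pi * Complex.I : ℂ) • B))).mul hE')
  rw [one_mul, one_mul, mul_one] at hL
  have hK' := hR.mul (TendstoPS.const _ K)
  rw [one_mul] at hK'
  refine hK'.unique (hL.congr ?_)
  filter_upwards [hmem] with t ht
  have h1 := heq _ ht
  rw [solution, solution, log_one_sub_inv ht, formalExp_add_smul, formalExp_add_smul] at h1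
  have hc : Commute (formalExp (-Complex.log (1 - ζ t) • B)) (formalExp (Complex.log (ζ t) • Λ)) :=
    commute_formalExp fun i => by
      rw [coeff_formalExp]
      exact ((((hB.smul_left _).symm).smul_left _).pow_right _).smul_right _
  have h2 := congrArg (formalExp (-Complex.log (1 - ζ t) • B) * ·) h1
  simp only [← mul_assoc] at h2 ⊢
  rw [hc.eq] at h2
  exact h2.symm

theorem hexagon_step {A B C' Λ : 𝒜} (hΛ : Λ = A + B + C') (hB : Commute Λ B)
    (hC : Commute Λ C') {z : ℂ} (hz : z ∈ lowerQuadrant) (hz' : z ∈ strip) :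
    solution A B z = formalExp (Complex.log z • Λ) * solution B C' (1 - z⁻¹) *
      (formalExp ((Real.pi * Complex.I : ℂ) • B) * drinfeldAssociator A B) := by
  rw [formalExp_log_mul_solution hΛ hB hC hz, solution_eq_mul_drinfeldAssociator A B hz',
    mul_assoc, ← mul_assoc (formalExp _) (formalExp _), formalExp_neg_mul, one_mul]

theorem exists_fixedPoint : ∃ z : ℂ, z ∈ lowerQuadrant ∧ z ∈ strip ∧ 1 - z⁻¹ = z ∧
    Complex.log z + Complex.log z + Complex.log z = -(Real.pi * Complex.I) := by
  have hlog : Complex.log (Complex.exp ((-(Real.pi / 3) : ℝ) * Complex.I)) =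
      (-(Real.pi / 3) : ℝ) * Complex.I := by
    refine Complex.log_exp ?_ ?_ <;> simp <;> linarith [Real.pi_pos]
  have hre : (Complex.exp ((-(Real.pi / 3) : ℝ) * Complex.I)).re = 1 / 2 := by
    rw [Complex.exp_ofReal_mul_I_re, Real.cos_neg, Real.cos_pi_div_three]
  have him : (Complex.exp ((-(Real.pi / 3) : ℝ) * Complex.I)).im = -(√3 / 2) := by
    rw [Complex.exp_ofReal_mul_I_im, Real.sin_neg, Real.sin_pi_div_three]
  have h3 : (0 : ℝ) < √3 := by positivity
  have hsq : √3 * √3 = (3 : ℝ) := Real.mul_self_sqrt (by norm_num)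
  set z := Complex.exp ((-(Real.pi / 3) : ℝ) * Complex.I) with hz
  have hz0 : z ≠ 0 := Complex.exp_ne_zero _
  refine ⟨z, ⟨?_, ?_⟩, ⟨?_, ?_⟩, ?_, ?_⟩
  · rw [mem_ofPred_eq, hre]; norm_num
  · rw [mem_ofPred_eq, him]; linarith
  · rw [mem_ofPred_eq, hre]; norm_num
  · rw [leftHalf, mem_ofPred_eq, hre]; norm_num
  · have h : z * z - z + 1 = 0 := by
      apply Complex.ext
      · simp [hre, him]; nlinarith
      · simp [hre, him]; ring
    field_simp
    linear_combination -h
  · rw [hlog]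
    push_cast
    ring

end Hexagon

end KZ

end

theorem mainTheorem2 {𝒜 : Type*} [Ring 𝒜] [Algebra ℂ 𝒜] (A B C Λ : 𝒜) (hΛ : Λ = A + B + C)
    (hA : A * Λ = Λ * A) (hB : B * Λ = Λ * B) (hC : C * Λ = Λ * C) :
    (KZ.IsDrinfeldAssociator A B (KZ.drinfeldAssociator A B) ∧
      KZ.IsDrinfeldAssociator B C (KZ.drinfeldAssociator B C) ∧
      KZ.IsDrinfeldAssociator C A (KZ.drinfeldAssociator C A)) ∧
    KZ.formalExp ((Real.pi * Complex.I : ℂ) • Λ) =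
      KZ.formalExp ((Real.pi * Complex.I : ℂ) • A) * KZ.drinfeldAssociator C A *
      KZ.formalExp ((Real.pi * Complex.I : ℂ) • C) * KZ.drinfeldAssociator B C *
      KZ.formalExp ((Real.pi * Complex.I : ℂ) • B) * KZ.drinfeldAssociator A B := by
  refine ⟨⟨KZ.isDrinfeldAssociator_drinfeldAssociator A B,
    KZ.isDrinfeldAssociator_drinfeldAssociator B C,
    KZ.isDrinfeldAssociator_drinfeldAssociator C A⟩, ?_⟩
  have hA' : Commute Λ A := hA.symm
  have hB' : Commute Λ B := hB.symm
  have hC' : Commute Λ C := hC.symm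
  obtain ⟨z, hz, hz', hfix, hlog⟩ := KZ.exists_fixedPoint
  have h1 := KZ.hexagon_step hΛ hB' hC' hz hz'
  have h2 := KZ.hexagon_step (A := B) (B := C) (C' := A) (Λ := Λ) (by rw [hΛ]; abel) hC' hA' hz hz'
  have h3 := KZ.hexagon_step (A := C) (B := A) (C' := B) (Λ := Λ) (by rw [hΛ]; abel) hA' hB' hz hz'
  rw [hfix] at h1 h2 h3
  have hcomm : Commute (KZ.formalExp ((Real.pi * Complex.I : ℂ) • Λ)) (KZ.solution A B z) :=
    KZ.commute_formalExp fun i => (KZ.commute_solution hA' hB' hz'.2 i).smul_left _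
  obtain ⟨V, -, hV⟩ := KZ.exists_inverse (KZ.coeff_zero_solution A B z)
  set P := KZ.formalExp ((Real.pi * Complex.I : ℂ) • A) * KZ.drinfeldAssociator C A *
      KZ.formalExp ((Real.pi * Complex.I : ℂ) • C) * KZ.drinfeldAssociator B C *
      KZ.formalExp ((Real.pi * Complex.I : ℂ) • B) * KZ.drinfeldAssociator A B with hP
  have h4 : KZ.solution A B z =
      KZ.formalExp (-(Real.pi * Complex.I : ℂ) • Λ) * (KZ.solution A B z * P) := by
    rw [← hlog, KZ.formalExp_add_smul, KZ.formalExp_add_smul, hP]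
    conv_lhs => rw [h1, h2, h3]
    simp only [mul_assoc]
  have h5 : KZ.solution A B z * KZ.formalExp ((Real.pi * Complex.I : ℂ) • Λ) =
      KZ.solution A B z * P := by
    rw [← hcomm.eq]
    conv_lhs => rw [h4]
    rw [← mul_assoc, KZ.formalExp_mul_neg, one_mul]
  have h6 := congrArg (V * ·) h5
  simpa only [← mul_assoc, hV, one_mul] using h6
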